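/- \textbf{Conventions.} For a set $X$, a multigraph on $X$ is a family of sets $\Phi(c_1,\dots,c_n;e)$ indexed by $n\ge 0$ and $c_1,\dots,c_n,e\in X$; a (symmetric) multicategory with object set $X$ has such sets of arrows, with an identity $1_x\in M(x;x)$ for each $x$, associative and unital composition $f\circ(g_1,\dots,g_n)$ (and, in the symmetric case, a left action of the symmetric groups, $\sigma\cdot-: M(b_{\sigma 1},\dots,b_{\sigma n};e)\to M(b_1,\dots,b_n;e)$, compatible with composition). $\mathrm{Multicat}_X$ and $\Sigma\text{-}\mathrm{Multicat}_X$ denote the categories of these and their identity-on-objects morphisms; $F_{\mathrm{pl}}\dashv U^{\mathrm{pl}}$ and $F_\Sigma\dashv U^\Sigma$ are the free/forgetful adjunctions with the category of multigraphs on $X$. A symmetric operad is a symmetric multicategory with one object; a multigraph on a one-point set is a signature, i.e. a family of sets $(\Phi_n)_{n\ge 0}$. (Symmetric) $\mathbf{Cat}$-multicategories and $\mathbf{Cat}$-operads are the strictly $\mathbf{Cat}$-enriched versions, and $D_*$ turns each set of arrows into a discrete category. Given a regular epimorphism $\phi: F\Phi\to M$ (with $F=F_{\mathrm{pl}}$ in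 $\mathrm{Multicat}_X$, respectively $F=F_\Sigma$ in $\Sigma\text{-}\mathrm{Multicat}_X$), the \emph{weakening} $\mathrm{Wk}_\phi(M)$ is the (unique up to isomorphism) (symmetric) $\mathbf{Cat}$-multicategory through which $D_*\phi$ factors as $$D_*F\Phi \xrightarrow{\ b\ } \mathrm{Wk}_\phi(M)\xrightarrow{\ f\ } D_*M$$ with $b$ locally bijective on objects (i.e. bijective on objects of each category of arrows) and $f$ locally full and faithful. The \emph{unbiased weakening} $\mathrm{Wk}(M)$ is the weakening with respect to the counit $FUM\to M$. Two (symmetric) $\mathbf{Cat}$-multicategories $Q,R$ with object set $X$ are \emph{equivalent} if there are identity-on-objects morphisms $A:Q\to R$ and $B:R\to Q$ and invertible transformations $BA\cong 1_Q$, $AB\cong 1_R$, where a transformation $\alpha\to\beta$ is a family of natural transformations between the functors $Q(c_1,\dots,c_n;e)\to R(c_1,\dots,c_n;e)$ given by $\alpha$ and $\beta$, compatible with composition and identities (and with the symmetric group actions in the symmetric case). \textbf{Theorem.} \begin{enumerate} \item Let $P$ be a symmetric operad, $\Phi$ a signature and $\phi:F_\Sigma\Phi\to P$ a regular epimorphism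 of symmetric operads. Then $\mathrm{Wk}_\phi(P)$ is equivalent to $\mathrm{Wk}(P)$ as a symmetric $\mathbf{Cat}$-operad. \item Let $X$ be a set, $M$ a multicategory with object set $X$, $\Phi$ a multigraph on $X$ and $\phi:F_{\mathrm{pl}}\Phi\to M$ a regular epimorphism in $\mathrm{Multicat}_X$. Then $\mathrm{Wk}_\phi(M)$ is equivalent to $\mathrm{Wk}(M)$ as a $\mathbf{Cat}$-multicategory. \item Let $X$ be a set, $M$ a symmetric multicategory with object set $X$, $\Phi$ a multigraph on $X$ and $\phi:F_\Sigma\Phi\to M$ a regular epimorphism in $\Sigma\text{-}\mathrm{Multicat}_X$. Then $\mathrm{Wk}_\phi(M)$ is equivalent to $\mathrm{Wk}(M)$ as a symmetric $\mathbf{Cat}$-multicategory. \end{enumerate} -/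

import Mathlib

open CategoryTheory

universe u

/-! Conventions. A multicategory with a fixed set `X` of objects has, for every finite sequence
`c : Fin n → X` and every `e : X`, arrows `c₁, …, cₙ → e`. The source of a composite is a
concatenated sequence; sequences such as `c₁ ++ (c₂ ++ c₃)` and `(c₁ ++ c₂) ++ c₃` are equal but
not syntactically so, and `HEq` (written `≍`) is used for equality of arrows, or of 2-cells,
across such equalities of their indices. -/

namespace Multi

/-! ### Sequences -/

/-- The concatenation `c¹₁, …, c¹_{k₁}, …, cⁿ₁, …, cⁿ_{kₙ}` of sequences. -/
def concat {X : Type u} {n : ℕ} {k : Fin n → ℕ} (c : ∀ i, Fin (k i) → X) :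
    Fin (∑ i, k i) → X :=
  fun p => c (finSigmaFinEquiv.symm p).1 (finSigmaFinEquiv.symm p).2

theorem concat_apply {X : Type u} {n : ℕ} {k : Fin n → ℕ} (c : ∀ i, Fin (k i) → X)
    (s : Σ i, Fin (k i)) : concat c (finSigmaFinEquiv s) = c s.1 s.2 :=
  congrArg (fun s : Σ i, Fin (k i) => c s.1 s.2) (Equiv.symm_apply_apply _ s)

theorem ofFn_concat {X : Type u} : ∀ {n : ℕ} {k : Fin n → ℕ} (c : ∀ i, Fin (k i) → X),
    List.ofFn (concat c) = (List.ofFn fun i => List.ofFn (c i)).flatten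
  | 0, k, c => by simp
  | n + 1, k, c => by
    have h : concat c = Fin.append (concat fun i : Fin n => c i.castSucc) (c (Fin.last n)) ∘
        Fin.cast (Fin.sum_univ_castSucc k) := by
      funext p
      obtain ⟨⟨i, j⟩, rfl⟩ := finSigmaFinEquiv.surjective p
      rw [concat_apply, Function.comp]
      induction i using Fin.lastCases with
      | last =>
        have : Fin.cast (Fin.sum_univ_castSucc k) (finSigmaFinEquiv ⟨Fin.last n, j⟩) =
            Fin.natAdd (∑ i : Fin n, k i.castSucc) j := by
          ext; simp [finSigmaFinEquiv_apply]
          rfl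
        rw [this, Fin.append_right]
      | cast i =>
        have : Fin.cast (Fin.sum_univ_castSucc k) (finSigmaFinEquiv ⟨i.castSucc, j⟩) =
            Fin.castAdd (k (Fin.last n)) (finSigmaFinEquiv
              (n := fun i : Fin n => k i.castSucc) ⟨i, j⟩) := by
          ext; simp [finSigmaFinEquiv_apply]
        rw [this, Fin.append_left, concat_apply]
    rw [h, List.ofFn_succ', List.concat_eq_append, List.flatten_append, ← ofFn_concat,
      List.flatten_singleton, ← List.ofFn_fin_append]
    exact (List.ofFn_congr (Fin.sum_univ_castSucc k) _).trans rfl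

theorem sigma_ext {X : Type u} {m n : ℕ} {c : Fin m → X} {d : Fin n → X}
    (h : List.ofFn c = List.ofFn d) : (⟨m, c⟩ : Σ n, Fin n → X) = ⟨n, d⟩ :=
  List.equivSigmaTuple.symm.injective h

theorem concat_concat {X : Type u} {n : ℕ} {k : Fin n → ℕ} {l : ∀ i, Fin (k i) → ℕ}
    (b : ∀ i j, Fin (l i j) → X) :
    (⟨_, concat fun i => concat (b i)⟩ : Σ n, Fin n → X) =
      ⟨_, concat fun p => b (finSigmaFinEquiv.symm p).1 (finSigmaFinEquiv.symm p).2⟩ := by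
  apply sigma_ext
  have := ofFn_concat fun i j => List.ofFn (b i j)
  simp only [ofFn_concat]
  unfold concat at this
  rw [this, List.flatten_flatten, List.map_ofFn]
  rfl

theorem concat_one {X : Type u} {n : ℕ} (c : Fin n → X) :
    (⟨_, concat fun _ : Fin 1 => c⟩ : Σ n, Fin n → X) = ⟨n, c⟩ := by
  apply sigma_ext
  rw [ofFn_concat]
  simp

theorem concat_singletons {X : Type u} {n : ℕ} (c : Fin n → X) :
    (⟨_, concat fun i (_ : Fin 1) => c i⟩ : Σ n, Fin n → X) = ⟨n, c⟩ := by
  apply sigma_ext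
  rw [ofFn_concat]
  simp only [List.ofFn_succ, List.ofFn_zero]
  rw [List.ofFn_eq_map, List.ofFn_eq_map, ← List.flatMap_def, List.map_eq_flatMap]

/-- The block permutation `σ ∘ (1, …, 1)`: block `i`, of length `k (σ i)`, becomes block `σ i`. -/
def blockPerm {m n : ℕ} (σ : Fin m ≃ Fin n) (k : Fin n → ℕ) :
    Fin (∑ i, k (σ i)) ≃ Fin (∑ i, k i) :=
  finSigmaFinEquiv.symm.trans
    ((Equiv.sigmaCongrLeft (β := fun i => Fin (k i)) σ).trans finSigmaFinEquiv)

/-- The permutation `1 ∘ (ρ₁, …, ρₙ)`, which permutes the `i`-th block by `ρᵢ`. -/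
def sumPerm {n : ℕ} {k l : Fin n → ℕ} (ρ : ∀ i, Fin (k i) ≃ Fin (l i)) :
    Fin (∑ i, k i) ≃ Fin (∑ i, l i) :=
  finSigmaFinEquiv.symm.trans ((Equiv.sigmaCongrRight ρ).trans finSigmaFinEquiv)

theorem concat_blockPerm {X : Type u} {m n : ℕ} (σ : Fin m ≃ Fin n) {k : Fin n → ℕ}
    (c : ∀ i, Fin (k i) → X) (p : Fin (∑ i, k (σ i))) :
    concat (fun i => c (σ i)) p = concat c (blockPerm σ k p) :=
  (concat_apply c ⟨σ (finSigmaFinEquiv.symm p).1, (finSigmaFinEquiv.symm p).2⟩).symm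

theorem concat_sumPerm {X : Type u} {n : ℕ} {k l : Fin n → ℕ} (ρ : ∀ i, Fin (k i) ≃ Fin (l i))
    {b : ∀ i, Fin (k i) → X} {c : ∀ i, Fin (l i) → X} (h : ∀ i j, b i j = c i (ρ i j))
    (p : Fin (∑ i, k i)) : concat b p = concat c (sumPerm ρ p) :=
  (h _ _).trans (concat_apply c
    ⟨(finSigmaFinEquiv.symm p).1, ρ _ (finSigmaFinEquiv.symm p).2⟩).symm

theorem heq_plift {p q : Prop} (a : ULift.{u} (PLift p)) (b : ULift.{u} (PLift q)) : a ≍ b := by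
  obtain rfl : p = q := propext ⟨fun _ => b.down.down, fun _ => a.down.down⟩
  exact heq_of_eq (Subsingleton.elim a b)

end Multi

open Multi

/-! ### Multigraphs, multicategories and symmetric multicategories -/

/-- A multigraph with vertex set `X`: a set of funnels from `c₁, …, cₙ` to `e`, for all
`n`, `c₁, …, cₙ` and `e`. -/
def Multigraph (X : Type u) : Type (u + 1) :=
  ∀ n : ℕ, (Fin n → X) → X → Type u

/-- A (plain, small) multicategory with object set `X`. -/
structure Multicategory (X : Type u) where
  /-- the set of arrows from `c₁, …, cₙ` to `e` -/
  Hom : ∀ {n : ℕ}, (Fin n → X) → X → Type u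
  /-- identity arrows -/
  id : ∀ x : X, Hom (fun _ : Fin 1 => x) x
  /-- the composite `f ∘ (g₁, …, gₙ)` -/
  comp : ∀ {n : ℕ} {k : Fin n → ℕ} {d : Fin n → X} {c : ∀ i, Fin (k i) → X} {e : X},
    Hom d e → (∀ i, Hom (c i) (d i)) → Hom (concat c) e
  id_comp : ∀ {n : ℕ} {c : Fin n → X} {e : X} (f : Hom c e), comp (id e) (fun _ => f) ≍ f
  comp_id : ∀ {n : ℕ} {c : Fin n → X} {e : X} (f : Hom c e), comp f (fun i => id (c i)) ≍ f
  assoc : ∀ {n : ℕ} {k : Fin n → ℕ} {l : ∀ i, Fin (k i) → ℕ} {d : Fin n → X}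
    {c : ∀ i, Fin (k i) → X} {b : ∀ i j, Fin (l i j) → X} {e : X}
    (f : Hom d e) (g : ∀ i, Hom (c i) (d i)) (h : ∀ i j, Hom (b i j) (c i j)),
    comp f (fun i => comp (g i) (h i)) ≍
      comp (comp f g)
        (fun p => h (finSigmaFinEquiv.symm p).1 (finSigmaFinEquiv.symm p).2)

/-- A symmetric multicategory with object set `X`. A bijection `σ` from `{1, …, m}` to
`{1, …, n}` (so that `m = n`) acts by
`σ · - : C(b_{σ 1}, …, b_{σ n}; e) → C(b₁, …, bₙ; e)`, the analogue of
`(σ · f)(x₁, …, xₙ) = f(x_{σ 1}, …, x_{σ n})`. This is a left action. -/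
structure SymMulticategory (X : Type u) extends Multicategory X where
  /-- the symmetric group action -/
  act : ∀ {m n : ℕ} (σ : Fin m ≃ Fin n) {a : Fin m → X} {b : Fin n → X} {e : X},
    (∀ i, a i = b (σ i)) → Hom a e → Hom b e
  act_refl : ∀ {n : ℕ} {a : Fin n → X} {e : X} (f : Hom a e),
    act (Equiv.refl _) (fun _ => rfl) f = f
  act_act : ∀ {m n r : ℕ} (σ : Fin m ≃ Fin n) (ρ : Fin n ≃ Fin r) {a : Fin m → X}
    {b : Fin n → X} {c : Fin r → X} {e : X} (h : ∀ i, a i = b (σ i)) (h' : ∀ i, b i = c (ρ i))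
    (f : Hom a e), act ρ h' (act σ h f) = act (σ.trans ρ) (fun i => (h i).trans (h' (σ i))) f
  act_comp : ∀ {m n : ℕ} (σ : Fin m ≃ Fin n) {k : Fin n → ℕ} {d : Fin n → X}
    {c : ∀ i, Fin (k i) → X} {e : X} (f : Hom (fun i => d (σ i)) e) (g : ∀ i, Hom (c i) (d i)),
    comp (act σ (fun _ => rfl) f) g =
      act (blockPerm σ k) (concat_blockPerm σ c) (comp f (fun i => g (σ i)))
  comp_act : ∀ {n : ℕ} {k l : Fin n → ℕ} (ρ : ∀ i, Fin (k i) ≃ Fin (l i)) {d : Fin n → X}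
    {b : ∀ i, Fin (k i) → X} {c : ∀ i, Fin (l i) → X} {e : X}
    (h : ∀ i j, b i j = c i (ρ i j)) (f : Hom d e) (g : ∀ i, Hom (b i) (d i)),
    comp f (fun i => act (ρ i) (h i) (g i)) =
      act (sumPerm ρ) (concat_sumPerm ρ h) (comp f g)

/-- An identity-on-objects morphism of multicategories. -/
@[ext]
structure Multicategory.Mor {X : Type u} (M N : Multicategory X) where
  map : ∀ {n : ℕ} {c : Fin n → X} {e : X}, M.Hom c e → N.Hom c e
  map_id : ∀ x : X, map (M.id x) = N.id x
  map_comp : ∀ {n : ℕ} {k : Fin n → ℕ} {d : Fin n → X} {c : ∀ i, Fin (k i) → X} {e : X}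
    (f : M.Hom d e) (g : ∀ i, M.Hom (c i) (d i)),
    map (M.comp f g) = N.comp (map f) (fun i => map (g i))

/-- An identity-on-objects morphism of symmetric multicategories. -/
@[ext]
structure SymMulticategory.Mor {X : Type u} (M N : SymMulticategory X) extends
    Multicategory.Mor M.toMulticategory N.toMulticategory where
  map_act : ∀ {m n : ℕ} (σ : Fin m ≃ Fin n) {a : Fin m → X} {b : Fin n → X} {e : X}
    (h : ∀ i, a i = b (σ i)) (f : M.Hom a e), map (M.act σ h f) = N.act σ h (map f)

/-- The category of multicategories with object set `X` and identity-on-objects morphisms. -/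
instance Multicategory.instCategory {X : Type u} : Category.{u} (Multicategory X) where
  Hom M N := Multicategory.Mor M N
  id M := ⟨fun f => f, fun _ => rfl, fun _ _ => rfl⟩
  comp F G := ⟨fun f => G.map (F.map f),
    fun x => by rw [F.map_id, G.map_id], fun f g => by rw [F.map_comp, G.map_comp]⟩

/-- The category of symmetric multicategories with object set `X` and identity-on-objects
morphisms. -/
instance SymMulticategory.instCategory {X : Type u} : Category.{u} (SymMulticategory X) where
  Hom M N := SymMulticategory.Mor M N
  id M := 
    { map := fun f => f
      map_id := fun _ => rfl
      map_comp := fun _ _ => rfl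
      map_act := fun _ _ _ _ _ _ => rfl }
  comp F G := 
    { map := fun f => G.map (F.map f)
      map_id := fun x => by rw [F.map_id, G.map_id]
      map_comp := fun f g => by rw [F.map_comp, G.map_comp]
      map_act := fun σ _ _ _ h f => by rw [F.map_act, G.map_act] }

/-- The underlying multigraph of a multicategory. -/
def Multicategory.graph {X : Type u} (M : Multicategory X) : Multigraph X :=
  fun _ c e => M.Hom c e

/-- The underlying multigraph of a symmetric multicategory. -/
abbrev SymMulticategory.graph {X : Type u} (M : SymMulticategory X) : Multigraph X :=
  M.toMulticategory.graph

/-- An identity-on-vertices morphism of multigraphs. -/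
def MultigraphHom {X : Type u} (Φ Ψ : Multigraph X) : Type u :=
  ∀ ⦃n : ℕ⦄ ⦃c : Fin n → X⦄ ⦃e : X⦄, Φ n c e → Ψ n c e

/-! ### Free multicategories

The free multicategory on `Φ` consists of the formal composites of funnels of `Φ`, two of them
being identified if they agree under every interpretation of `Φ` in every multicategory; it has
the universal property `FreeMulticategory.existsUnique_lift`, by which it is determined up to
isomorphism. The symmetric case is the same with formal symmetric group actions. -/

/-- Formal composites of funnels of `Φ`. -/
inductive PlainTerm {X : Type u} (Φ : Multigraph X) : ∀ {n : ℕ}, (Fin n → X) → X → Type u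
  | gen {n : ℕ} {c : Fin n → X} {e : X} (a : Φ n c e) : PlainTerm Φ c e
  | id (x : X) : PlainTerm Φ (fun _ : Fin 1 => x) x
  | comp {n : ℕ} {k : Fin n → ℕ} {d : Fin n → X} {c : ∀ i, Fin (k i) → X} {e : X}
      (f : PlainTerm Φ d e) (g : ∀ i, PlainTerm Φ (c i) (d i)) : PlainTerm Φ (concat c) e

namespace PlainTerm

variable {X : Type u} {Φ : Multigraph X}

/-- The value of a formal composite under an interpretation of `Φ` in `M`. -/
def eval (M : Multicategory X) (a : MultigraphHom Φ M.graph) :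
    ∀ {n : ℕ} {c : Fin n → X} {e : X}, PlainTerm Φ c e → M.Hom c e
  | _, _, _, gen t => a t
  | _, _, _, id x => M.id x
  | _, _, _, comp f g => M.comp (eval M a f) (fun i => eval M a (g i))

/-- Two formal composites are identified if they agree under every interpretation. -/
def setoid (Φ : Multigraph X) {n : ℕ} (c : Fin n → X) (e : X) : Setoid (PlainTerm Φ c e) where
  r s t := ∀ (M : Multicategory.{u} X) (a : MultigraphHom Φ M.graph), s.eval M a = t.eval M a
  iseqv := ⟨fun _ _ _ => rfl, fun h M a => (h M a).symm, fun h h' M a => (h M a).trans (h' M a)⟩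

theorem eval_out (M : Multicategory X) (a : MultigraphHom Φ M.graph) {n : ℕ} {c : Fin n → X}
    {e : X} (t : PlainTerm Φ c e) : (Quotient.mk (setoid Φ c e) t).out.eval M a = t.eval M a :=
  Quotient.exact (Quotient.out_eq (Quotient.mk (setoid Φ c e) t)) M a

theorem mk_heq {m n : ℕ} {c : Fin m → X} {d : Fin n → X} {e : X}
    (h : (⟨m, c⟩ : Σ n, Fin n → X) = ⟨n, d⟩) (s : PlainTerm Φ c e) (t : PlainTerm Φ d e)
    (H : ∀ (M : Multicategory X) (a : MultigraphHom Φ M.graph), s.eval M a ≍ t.eval M a) :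
    Quotient.mk (setoid Φ c e) s ≍ Quotient.mk (setoid Φ d e) t := by
  cases h
  exact heq_of_eq (Quotient.sound fun M a => eq_of_heq (H M a))

end PlainTerm

/-- The free multicategory on the multigraph `Φ`. -/
noncomputable def FreeMulticategory {X : Type u} (Φ : Multigraph X) : Multicategory X where
  Hom c e := Quotient (PlainTerm.setoid Φ c e)
  id x := Quotient.mk _ (PlainTerm.id x)
  comp f g := Quotient.mk _ (PlainTerm.comp f.out fun i => (g i).out)
  id_comp {n c e} f := by
    induction f using Quotient.inductionOn with | h f
    refine PlainTerm.mk_heq (concat_one c) _ _ fun M a => ?_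
    simp only [PlainTerm.eval, PlainTerm.eval_out]
    exact M.id_comp _
  comp_id {n c e} f := by
    induction f using Quotient.inductionOn with | h f
    refine PlainTerm.mk_heq (concat_singletons c) _ _ fun M a => ?_
    simp only [PlainTerm.eval, PlainTerm.eval_out]
    exact M.comp_id _
  assoc f g h := by
    refine PlainTerm.mk_heq (concat_concat _) _ _ fun M a => ?_
    simp only [PlainTerm.eval, PlainTerm.eval_out]
    exact M.assoc _ _ _

namespace FreeMulticategory

variable {X : Type u} {Φ : Multigraph X}

/-- The arrow represented by a formal composite. -/
def mk {n : ℕ} {c : Fin n → X} {e : X} (t : PlainTerm Φ c e) : (FreeMulticategory Φ).Hom c e :=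
  Quotient.mk _ t

theorem mk_id (x : X) : mk (PlainTerm.id x) = (FreeMulticategory Φ).id x :=
  rfl

theorem mk_comp {n : ℕ} {k : Fin n → ℕ} {d : Fin n → X} {c : ∀ i, Fin (k i) → X} {e : X}
    (f : PlainTerm Φ d e) (g : ∀ i, PlainTerm Φ (c i) (d i)) :
    mk (PlainTerm.comp f g) = (FreeMulticategory Φ).comp (mk f) (fun i => mk (g i)) :=
  Quotient.sound fun M a => by simp only [PlainTerm.eval, mk, PlainTerm.eval_out]

/-- The inclusion of the generators. -/
def unit (Φ : Multigraph X) : MultigraphHom Φ (FreeMulticategory Φ).graph :=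
  fun _ _ _ t => mk (PlainTerm.gen t)

/-- The morphism out of the free multicategory induced by a map of multigraphs. -/
noncomputable def lift (M : Multicategory X) (a : MultigraphHom Φ M.graph) : FreeMulticategory Φ ⟶ M where
  map f := PlainTerm.eval M a (Quotient.out f)
  map_id _ := PlainTerm.eval_out M a _
  map_comp _ _ := PlainTerm.eval_out M a _

/-- The counit at `M` of the adjunction between the free and the forgetful functor. -/
noncomputable def counit (M : Multicategory X) : FreeMulticategory M.graph ⟶ M :=
  lift M fun _ _ _ f => f

theorem existsUnique_lift (M : Multicategory X) (a : MultigraphHom Φ M.graph) :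
    ∃! F : FreeMulticategory Φ ⟶ M, ∀ {n : ℕ} {c : Fin n → X} {e : X} (t : Φ n c e),
      F.map (unit Φ t) = a t := by
  refine ⟨lift M a, fun _ => PlainTerm.eval_out M a _, fun F hF => ?_⟩
  have key : ∀ {n : ℕ} {c : Fin n → X} {e : X} (t : PlainTerm Φ c e),
      F.map (mk t) = t.eval M a := by
    intro n c e t
    induction t with
    | gen t => exact hF t
    | id x => exact F.map_id x
    | comp f g hf hg =>
      rw [mk_comp, F.map_comp, hf]
      simp only [hg, PlainTerm.eval]
  apply Multicategory.Mor.ext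
  funext n c e f
  induction f using Quotient.inductionOn with | h f
  exact (key f).trans (PlainTerm.eval_out M a f).symm

end FreeMulticategory

/-- Formal composites of funnels of `Φ` and symmetric group actions. -/
inductive SymTerm {X : Type u} (Φ : Multigraph X) : ∀ {n : ℕ}, (Fin n → X) → X → Type u
  | gen {n : ℕ} {c : Fin n → X} {e : X} (a : Φ n c e) : SymTerm Φ c e
  | id (x : X) : SymTerm Φ (fun _ : Fin 1 => x) x
  | comp {n : ℕ} {k : Fin n → ℕ} {d : Fin n → X} {c : ∀ i, Fin (k i) → X} {e : X}
      (f : SymTerm Φ d e) (g : ∀ i, SymTerm Φ (c i) (d i)) : SymTerm Φ (concat c) e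
  | act {m n : ℕ} (σ : Fin m ≃ Fin n) {a : Fin m → X} {b : Fin n → X} {e : X}
      (h : ∀ i, a i = b (σ i)) (f : SymTerm Φ a e) : SymTerm Φ b e

namespace SymTerm

variable {X : Type u} {Φ : Multigraph X}

/-- The value of a formal composite under an interpretation of `Φ` in `M`. -/
def eval (M : SymMulticategory X) (a : MultigraphHom Φ M.graph) :
    ∀ {n : ℕ} {c : Fin n → X} {e : X}, SymTerm Φ c e → M.Hom c e
  | _, _, _, gen t => a t
  | _, _, _, id x => M.id x
  | _, _, _, comp f g => M.comp (eval M a f) (fun i => eval M a (g i))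
  | _, _, _, act σ h f => M.act σ h (eval M a f)

/-- Two formal composites are identified if they agree under every interpretation. -/
def setoid (Φ : Multigraph X) {n : ℕ} (c : Fin n → X) (e : X) : Setoid (SymTerm Φ c e) where
  r s t := ∀ (M : SymMulticategory.{u} X) (a : MultigraphHom Φ M.graph), s.eval M a = t.eval M a
  iseqv := ⟨fun _ _ _ => rfl, fun h M a => (h M a).symm, fun h h' M a => (h M a).trans (h' M a)⟩

theorem eval_out (M : SymMulticategory X) (a : MultigraphHom Φ M.graph) {n : ℕ} {c : Fin n → X}
    {e : X} (t : SymTerm Φ c e) : (Quotient.mk (setoid Φ c e) t).out.eval M a = t.eval M a :=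
  Quotient.exact (Quotient.out_eq (Quotient.mk (setoid Φ c e) t)) M a

theorem mk_heq {m n : ℕ} {c : Fin m → X} {d : Fin n → X} {e : X}
    (h : (⟨m, c⟩ : Σ n, Fin n → X) = ⟨n, d⟩) (s : SymTerm Φ c e) (t : SymTerm Φ d e)
    (H : ∀ (M : SymMulticategory X) (a : MultigraphHom Φ M.graph), s.eval M a ≍ t.eval M a) :
    Quotient.mk (setoid Φ c e) s ≍ Quotient.mk (setoid Φ d e) t := by
  cases h
  exact heq_of_eq (Quotient.sound fun M a => eq_of_heq (H M a))

end SymTerm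

/-- The free symmetric multicategory on the multigraph `Φ`. -/
noncomputable def FreeSymMulticategory {X : Type u} (Φ : Multigraph X) : SymMulticategory X where
  Hom c e := Quotient (SymTerm.setoid Φ c e)
  id x := Quotient.mk _ (SymTerm.id x)
  comp f g := Quotient.mk _ (SymTerm.comp f.out fun i => (g i).out)
  act σ _ _ _ h f := Quotient.mk _ (SymTerm.act σ h f.out)
  id_comp {n c e} f := by
    induction f using Quotient.inductionOn with | h f
    refine SymTerm.mk_heq (concat_one c) _ _ fun M a => ?_
    simp only [SymTerm.eval, SymTerm.eval_out]
    exact M.id_comp _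
  comp_id {n c e} f := by
    induction f using Quotient.inductionOn with | h f
    refine SymTerm.mk_heq (concat_singletons c) _ _ fun M a => ?_
    simp only [SymTerm.eval, SymTerm.eval_out]
    exact M.comp_id _
  assoc f g h := by
    refine SymTerm.mk_heq (concat_concat _) _ _ fun M a => ?_
    simp only [SymTerm.eval, SymTerm.eval_out]
    exact M.assoc _ _ _
  act_refl f := by
    induction f using Quotient.inductionOn with | h f
    refine Quotient.sound fun M a => ?_
    simp only [SymTerm.eval, SymTerm.eval_out]
    exact M.act_refl _
  act_act σ ρ _ _ _ _ h h' f := by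
    refine Quotient.sound fun M a => ?_
    simp only [SymTerm.eval, SymTerm.eval_out]
    exact M.act_act _ _ _ _ _
  act_comp σ _ _ _ _ f g := by
    refine Quotient.sound fun M a => ?_
    simp only [SymTerm.eval, SymTerm.eval_out]
    exact M.act_comp _ _ _
  comp_act ρ _ _ _ _ h f g := by
    refine Quotient.sound fun M a => ?_
    simp only [SymTerm.eval, SymTerm.eval_out]
    exact M.comp_act _ _ _ _

namespace FreeSymMulticategory

variable {X : Type u} {Φ : Multigraph X}

/-- The arrow represented by a formal composite. -/
def mk {n : ℕ} {c : Fin n → X} {e : X} (t : SymTerm Φ c e) : (FreeSymMulticategory Φ).Hom c e :=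
  Quotient.mk _ t

theorem mk_id (x : X) : mk (SymTerm.id x) = (FreeSymMulticategory Φ).id x :=
  rfl

theorem mk_comp {n : ℕ} {k : Fin n → ℕ} {d : Fin n → X} {c : ∀ i, Fin (k i) → X} {e : X}
    (f : SymTerm Φ d e) (g : ∀ i, SymTerm Φ (c i) (d i)) :
    mk (SymTerm.comp f g) = (FreeSymMulticategory Φ).comp (mk f) (fun i => mk (g i)) :=
  Quotient.sound fun M a => by simp only [SymTerm.eval, mk, SymTerm.eval_out]

theorem mk_act {m n : ℕ} (σ : Fin m ≃ Fin n) {a : Fin m → X} {b : Fin n → X} {e : X}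
    (h : ∀ i, a i = b (σ i)) (f : SymTerm Φ a e) :
    mk (SymTerm.act σ h f) = (FreeSymMulticategory Φ).act σ h (mk f) :=
  Quotient.sound fun M a => by simp only [SymTerm.eval, mk, SymTerm.eval_out]

/-- The inclusion of the generators. -/
def unit (Φ : Multigraph X) : MultigraphHom Φ (FreeSymMulticategory Φ).graph :=
  fun _ _ _ t => mk (SymTerm.gen t)

/-- The morphism out of the free symmetric multicategory induced by a map of multigraphs. -/
noncomputable def lift (M : SymMulticategory X) (a : MultigraphHom Φ M.graph) :
    FreeSymMulticategory Φ ⟶ M where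
  map f := SymTerm.eval M a (Quotient.out f)
  map_id _ := SymTerm.eval_out M a _
  map_comp _ _ := SymTerm.eval_out M a _
  map_act _ _ _ _ _ _ := SymTerm.eval_out M a _

/-- The counit at `M` of the adjunction between the free and the forgetful functor. -/
noncomputable def counit (M : SymMulticategory X) : FreeSymMulticategory M.graph ⟶ M :=
  lift M fun _ _ _ f => f

theorem existsUnique_lift (M : SymMulticategory X) (a : MultigraphHom Φ M.graph) :
    ∃! F : FreeSymMulticategory Φ ⟶ M, ∀ {n : ℕ} {c : Fin n → X} {e : X} (t : Φ n c e),
      F.map (unit Φ t) = a t := by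
  refine ⟨lift M a, fun _ => SymTerm.eval_out M a _, fun F hF => ?_⟩
  have key : ∀ {n : ℕ} {c : Fin n → X} {e : X} (t : SymTerm Φ c e),
      F.map (mk t) = t.eval M a := by
    intro n c e t
    induction t with
    | gen t => exact hF t
    | id x => exact F.map_id x
    | comp f g hf hg =>
      rw [mk_comp, F.map_comp, hf]
      simp only [hg, SymTerm.eval]
    | act σ h f hf =>
      rw [mk_act, F.map_act, hf]
      simp only [SymTerm.eval]
  apply SymMulticategory.Mor.ext
  funext n c e f
  induction f using Quotient.inductionOn with | h f
  exact (key f).trans (SymTerm.eval_out M a f).symm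

end FreeSymMulticategory

/-! ### Cat-enriched multicategories -/

/-- A multicategory enriched in categories, with object set `X`: the arrows `c₁, …, cₙ → e`
(1-cells) are the objects of a category, whose morphisms are the 2-cells, and composition is a
functor (`comp`, `comp₂`), strictly associative and unital. -/
structure CatMulticategory (X : Type u) extends Multicategory X where
  [category : ∀ {n : ℕ} (c : Fin n → X) (e : X), Category.{u} (Hom c e)]
  /-- composition of 2-cells -/
  comp₂ : ∀ {n : ℕ} {k : Fin n → ℕ} {d : Fin n → X} {c : ∀ i, Fin (k i) → X} {e : X}
    {f f' : Hom d e} {g g' : ∀ i, Hom (c i) (d i)},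
    (f ⟶ f') → (∀ i, g i ⟶ g' i) → (comp f g ⟶ comp f' g')
  comp₂_one : ∀ {n : ℕ} {k : Fin n → ℕ} {d : Fin n → X} {c : ∀ i, Fin (k i) → X} {e : X}
    (f : Hom d e) (g : ∀ i, Hom (c i) (d i)), comp₂ (𝟙 f) (fun i => 𝟙 (g i)) = 𝟙 (comp f g)
  comp₂_vcomp : ∀ {n : ℕ} {k : Fin n → ℕ} {d : Fin n → X} {c : ∀ i, Fin (k i) → X} {e : X}
    {f f' f'' : Hom d e} {g g' g'' : ∀ i, Hom (c i) (d i)} (α : f ⟶ f') (α' : f' ⟶ f'')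
    (β : ∀ i, g i ⟶ g' i) (β' : ∀ i, g' i ⟶ g'' i),
    comp₂ (α ≫ α') (fun i => β i ≫ β' i) = comp₂ α β ≫ comp₂ α' β'
  id_comp₂ : ∀ {n : ℕ} {c : Fin n → X} {e : X} {f f' : Hom c e} (α : f ⟶ f'),
    comp₂ (𝟙 (id e)) (fun _ => α) ≍ α
  comp_id₂ : ∀ {n : ℕ} {c : Fin n → X} {e : X} {f f' : Hom c e} (α : f ⟶ f'),
    comp₂ α (fun i => 𝟙 (id (c i))) ≍ α
  assoc₂ : ∀ {n : ℕ} {k : Fin n → ℕ} {l : ∀ i, Fin (k i) → ℕ} {d : Fin n → X}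
    {c : ∀ i, Fin (k i) → X} {b : ∀ i j, Fin (l i j) → X} {e : X}
    {f f' : Hom d e} {g g' : ∀ i, Hom (c i) (d i)} {h h' : ∀ i j, Hom (b i j) (c i j)}
    (α : f ⟶ f') (β : ∀ i, g i ⟶ g' i) (γ : ∀ i j, h i j ⟶ h' i j),
    comp₂ α (fun i => comp₂ (β i) (γ i)) ≍
      comp₂ (comp₂ α β)
        (fun p => γ (finSigmaFinEquiv.symm p).1 (finSigmaFinEquiv.symm p).2)

attribute [instance] CatMulticategory.category

/-- A symmetric multicategory enriched in categories: the symmetric groups act by functors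
(`act`, `act₂`), strictly satisfying the equations of a symmetric multicategory. -/
structure SymCatMulticategory (X : Type u) extends CatMulticategory X, SymMulticategory X where
  /-- the symmetric group action on 2-cells -/
  act₂ : ∀ {m n : ℕ} (σ : Fin m ≃ Fin n) {a : Fin m → X} {b : Fin n → X} {e : X}
    (h : ∀ i, a i = b (σ i)) {f f' : Hom a e}, (f ⟶ f') → (act σ h f ⟶ act σ h f')
  act₂_one : ∀ {m n : ℕ} (σ : Fin m ≃ Fin n) {a : Fin m → X} {b : Fin n → X} {e : X}
    (h : ∀ i, a i = b (σ i)) (f : Hom a e), act₂ σ h (𝟙 f) = 𝟙 (act σ h f)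
  act₂_vcomp : ∀ {m n : ℕ} (σ : Fin m ≃ Fin n) {a : Fin m → X} {b : Fin n → X} {e : X}
    (h : ∀ i, a i = b (σ i)) {f f' f'' : Hom a e} (α : f ⟶ f') (α' : f' ⟶ f''),
    act₂ σ h (α ≫ α') = act₂ σ h α ≫ act₂ σ h α'
  act_refl₂ : ∀ {n : ℕ} {a : Fin n → X} {e : X} {f f' : Hom a e} (α : f ⟶ f'),
    act₂ (Equiv.refl _) (fun _ => rfl) α ≍ α
  act_act₂ : ∀ {m n r : ℕ} (σ : Fin m ≃ Fin n) (ρ : Fin n ≃ Fin r) {a : Fin m → X}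
    {b : Fin n → X} {c : Fin r → X} {e : X} (h : ∀ i, a i = b (σ i)) (h' : ∀ i, b i = c (ρ i))
    {f f' : Hom a e} (α : f ⟶ f'),
    act₂ ρ h' (act₂ σ h α) ≍ act₂ (σ.trans ρ) (fun i => (h i).trans (h' (σ i))) α
  act_comp₂ : ∀ {m n : ℕ} (σ : Fin m ≃ Fin n) {k : Fin n → ℕ} {d : Fin n → X}
    {c : ∀ i, Fin (k i) → X} {e : X} {f f' : Hom (fun i => d (σ i)) e}
    {g g' : ∀ i, Hom (c i) (d i)} (α : f ⟶ f') (β : ∀ i, g i ⟶ g' i),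
    comp₂ (act₂ σ (fun _ => rfl) α) β ≍
      act₂ (blockPerm σ k) (concat_blockPerm σ c) (comp₂ α (fun i => β (σ i)))
  comp_act₂ : ∀ {n : ℕ} {k l : Fin n → ℕ} (ρ : ∀ i, Fin (k i) ≃ Fin (l i)) {d : Fin n → X}
    {b : ∀ i, Fin (k i) → X} {c : ∀ i, Fin (l i) → X} {e : X}
    (h : ∀ i j, b i j = c i (ρ i j)) {f f' : Hom d e} {g g' : ∀ i, Hom (b i) (d i)}
    (α : f ⟶ f') (β : ∀ i, g i ⟶ g' i),
    comp₂ α (fun i => act₂ (ρ i) (h i) (β i)) ≍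
      act₂ (sumPerm ρ) (concat_sumPerm ρ h) (comp₂ α β)

/-- An identity-on-objects morphism of Cat-multicategories. -/
@[ext]
structure CatMulticategory.Mor {X : Type u} (Q R : CatMulticategory X) extends
    Multicategory.Mor Q.toMulticategory R.toMulticategory where
  map₂ : ∀ {n : ℕ} {c : Fin n → X} {e : X} {f f' : Q.Hom c e}, (f ⟶ f') → (map f ⟶ map f')
  map₂_one : ∀ {n : ℕ} {c : Fin n → X} {e : X} (f : Q.Hom c e), map₂ (𝟙 f) = 𝟙 (map f)
  map₂_vcomp : ∀ {n : ℕ} {c : Fin n → X} {e : X} {f f' f'' : Q.Hom c e} (α : f ⟶ f')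
    (α' : f' ⟶ f''), map₂ (α ≫ α') = map₂ α ≫ map₂ α'
  map₂_comp₂ : ∀ {n : ℕ} {k : Fin n → ℕ} {d : Fin n → X} {c : ∀ i, Fin (k i) → X} {e : X}
    {f f' : Q.Hom d e} {g g' : ∀ i, Q.Hom (c i) (d i)} (α : f ⟶ f') (β : ∀ i, g i ⟶ g' i),
    map₂ (Q.comp₂ α β) ≍ R.comp₂ (map₂ α) (fun i => map₂ (β i))

/-- An identity-on-objects morphism of symmetric Cat-multicategories. -/
@[ext]
structure SymCatMulticategory.Mor {X : Type u} (Q R : SymCatMulticategory X) extends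
    toCatMor : CatMulticategory.Mor Q.toCatMulticategory R.toCatMulticategory,
    toSymMor : SymMulticategory.Mor Q.toSymMulticategory R.toSymMulticategory where
  map₂_act₂ : ∀ {m n : ℕ} (σ : Fin m ≃ Fin n) {a : Fin m → X} {b : Fin n → X} {e : X}
    (h : ∀ i, a i = b (σ i)) {f f' : Q.Hom a e} (α : f ⟶ f'),
    map₂ (Q.act₂ σ h α) ≍ R.act₂ σ h (map₂ α)

theorem CatMulticategory.Mor.map₂_heq {X : Type u} {Q R : CatMulticategory X}
    (F : CatMulticategory.Mor Q R) {n : ℕ} {c : Fin n → X} {e : X} {f f' g g' : Q.Hom c e}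
    (h : f = g) (h' : f' = g') {α : f ⟶ f'} {β : g ⟶ g'} (H : α ≍ β) :
    F.map₂ α ≍ F.map₂ β := by
  subst h h'
  rw [eq_of_heq H]

namespace CatMulticategory

variable {X : Type u}

/-- The identity morphism. -/
def Mor.id (Q : CatMulticategory X) : Mor Q Q where
  map f := f
  map_id _ := rfl
  map_comp _ _ := rfl
  map₂ α := α
  map₂_one _ := rfl
  map₂_vcomp _ _ := rfl
  map₂_comp₂ _ _ := HEq.rfl

/-- The composite `G ∘ F`. -/
def Mor.comp {Q R S : CatMulticategory X} (F : Mor Q R) (G : Mor R S) : Mor Q S where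
  map f := G.map (F.map f)
  map_id _ := by rw [F.map_id, G.map_id]
  map_comp _ _ := by rw [F.map_comp, G.map_comp]
  map₂ α := G.map₂ (F.map₂ α)
  map₂_one _ := by rw [F.map₂_one, G.map₂_one]
  map₂_vcomp _ _ := by rw [F.map₂_vcomp, G.map₂_vcomp]
  map₂_comp₂ α β := (G.map₂_heq (F.map_comp _ _) (F.map_comp _ _) (F.map₂_comp₂ α β)).trans
    (G.map₂_comp₂ _ _)

/-- A transformation between morphisms of Cat-multicategories: a family of natural
transformations, compatible with composition and identities. -/
structure Transformation {Q R : CatMulticategory X} (F G : Mor Q R) where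
  app : ∀ {n : ℕ} {c : Fin n → X} {e : X} (f : Q.Hom c e), F.map f ⟶ G.map f
  naturality : ∀ {n : ℕ} {c : Fin n → X} {e : X} {f f' : Q.Hom c e} (α : f ⟶ f'),
    F.map₂ α ≫ app f' = app f ≫ G.map₂ α
  app_id : ∀ x : X, app (Q.id x) ≍ 𝟙 (R.id x)
  app_comp : ∀ {n : ℕ} {k : Fin n → ℕ} {d : Fin n → X} {c : ∀ i, Fin (k i) → X} {e : X}
    (f : Q.Hom d e) (g : ∀ i, Q.Hom (c i) (d i)),
    app (Q.comp f g) ≍ R.comp₂ (app f) (fun i => app (g i))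

/-- An invertible transformation. -/
structure TransformationIso {Q R : CatMulticategory X} (F G : Mor Q R) where
  hom : Transformation F G
  inv : Transformation G F
  hom_inv_id : ∀ {n : ℕ} {c : Fin n → X} {e : X} (f : Q.Hom c e),
    hom.app f ≫ inv.app f = 𝟙 (F.map f)
  inv_hom_id : ∀ {n : ℕ} {c : Fin n → X} {e : X} (f : Q.Hom c e),
    inv.app f ≫ hom.app f = 𝟙 (G.map f)

/-- Equivalence in the 2-category of Cat-multicategories with object set `X`. -/
def Equivalent (Q R : CatMulticategory X) : Prop :=
  ∃ (F : Mor Q R) (G : Mor R Q), Nonempty (TransformationIso (F.comp G) (Mor.id Q)) ∧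
    Nonempty (TransformationIso (G.comp F) (Mor.id R))

/-- Locally bijective on objects, i.e. bijective on 1-cells. -/
def Mor.LocallyBijectiveOnObjects {Q R : CatMulticategory X} (F : Mor Q R) : Prop :=
  ∀ {n : ℕ} (c : Fin n → X) (e : X),
    Function.Bijective (F.map : Q.Hom c e → R.Hom c e)

/-- Locally full and faithful. -/
def Mor.LocallyFullyFaithful {Q R : CatMulticategory X} (F : Mor Q R) : Prop :=
  ∀ {n : ℕ} {c : Fin n → X} {e : X} (f f' : Q.Hom c e),
    Function.Bijective (F.map₂ : (f ⟶ f') → (F.map f ⟶ F.map f'))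

end CatMulticategory

namespace SymCatMulticategory

variable {X : Type u}

/-- The identity morphism. -/
def Mor.id (Q : SymCatMulticategory X) : Mor Q Q where
  toCatMor := CatMulticategory.Mor.id Q.toCatMulticategory
  map_act _ _ _ _ _ _ := rfl
  map₂_act₂ _ _ _ _ _ _ _ _ := HEq.rfl

/-- The composite `G ∘ F`. -/
def Mor.comp {Q R S : SymCatMulticategory X} (F : Mor Q R) (G : Mor R S) : Mor Q S where
  toCatMor := F.toCatMor.comp G.toCatMor
  map_act σ _ _ _ h f := (congrArg G.map (F.map_act σ h f)).trans (G.map_act σ h _)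
  map₂_act₂ σ _ _ _ h _ _ α :=
    (G.toCatMor.map₂_heq (F.map_act σ h _) (F.map_act σ h _) (F.map₂_act₂ σ h α)).trans
      (G.map₂_act₂ σ h _)

/-- A transformation between morphisms of symmetric Cat-multicategories: a family of natural
transformations, compatible with composition, identities and symmetric group actions. -/
structure Transformation {Q R : SymCatMulticategory X} (F G : Mor Q R) extends
    CatMulticategory.Transformation F.toCatMor G.toCatMor where
  app_act : ∀ {m n : ℕ} (σ : Fin m ≃ Fin n) {a : Fin m → X} {b : Fin n → X} {e : X}
    (h : ∀ i, a i = b (σ i)) (f : Q.Hom a e), app (Q.act σ h f) ≍ R.act₂ σ h (app f)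

/-- An invertible transformation. -/
structure TransformationIso {Q R : SymCatMulticategory X} (F G : Mor Q R) where
  hom : Transformation F G
  inv : Transformation G F
  hom_inv_id : ∀ {n : ℕ} {c : Fin n → X} {e : X} (f : Q.Hom c e),
    hom.app f ≫ inv.app f = 𝟙 (F.map f)
  inv_hom_id : ∀ {n : ℕ} {c : Fin n → X} {e : X} (f : Q.Hom c e),
    inv.app f ≫ hom.app f = 𝟙 (G.map f)

/-- Equivalence in the 2-category of symmetric Cat-multicategories with object set `X`. -/
def Equivalent (Q R : SymCatMulticategory X) : Prop :=
  ∃ (F : Mor Q R) (G : Mor R Q), Nonempty (TransformationIso (F.comp G) (Mor.id Q)) ∧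
    Nonempty (TransformationIso (G.comp F) (Mor.id R))

end SymCatMulticategory

/-! ### Weakenings -/

namespace Multicategory

variable {X : Type u}

/-- The functor `D_*` on objects: `M` with only identity 2-cells. -/
def discrete (M : Multicategory X) : CatMulticategory X where
  toMulticategory := M
  category _ _ :=
    { Hom := fun f g => ULift (PLift (f = g))
      id := fun f => ⟨⟨rfl⟩⟩
      comp := fun α β => ⟨⟨α.down.down.trans β.down.down⟩⟩ }
  comp₂ α β := ⟨⟨by rw [α.down.down, funext fun i => (β i).down.down]⟩⟩
  comp₂_one _ _ := rfl
  comp₂_vcomp _ _ _ _ := rfl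
  id_comp₂ _ := heq_plift _ _
  comp_id₂ _ := heq_plift _ _
  assoc₂ _ _ _ := heq_plift _ _

/-- The functor `D_*` on morphisms. -/
def discreteMap {M N : Multicategory X} (φ : M ⟶ N) :
    CatMulticategory.Mor M.discrete N.discrete where
  toMor := φ
  map₂ α := ⟨⟨congrArg φ.map α.down.down⟩⟩
  map₂_one _ := rfl
  map₂_vcomp _ _ := rfl
  map₂_comp₂ _ _ := heq_plift _ _

/-- `Q` is the weakening determined by `φ : N ⟶ M`: it is the middle term of a factorization of
`D_* φ` into a morphism locally bijective on objects and a locally full and faithful one. -/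
def IsWeakening {N M : Multicategory X} (φ : N ⟶ M) (Q : CatMulticategory X) : Prop :=
  ∃ (b : CatMulticategory.Mor N.discrete Q) (f : CatMulticategory.Mor Q M.discrete),
    b.LocallyBijectiveOnObjects ∧ f.LocallyFullyFaithful ∧ b.comp f = discreteMap φ

/-- The standard model: a unique 2-cell `f → g` if `φ f = φ g`, and none otherwise. -/
def weakening {N M : Multicategory X} (φ : N ⟶ M) : CatMulticategory X where
  toMulticategory := N
  category _ _ :=
    { Hom := fun f g => ULift (PLift (φ.map f = φ.map g))
      id := fun f => ⟨⟨rfl⟩⟩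
      comp := fun α β => ⟨⟨α.down.down.trans β.down.down⟩⟩ }
  comp₂ α β := ⟨⟨by rw [φ.map_comp, φ.map_comp, α.down.down, funext fun i => (β i).down.down]⟩⟩
  comp₂_one _ _ := rfl
  comp₂_vcomp _ _ _ _ := rfl
  id_comp₂ _ := heq_plift _ _
  comp_id₂ _ := heq_plift _ _
  assoc₂ _ _ _ := heq_plift _ _

/-- Weakenings exist. -/
theorem isWeakening_weakening {N M : Multicategory X} (φ : N ⟶ M) :
    IsWeakening φ (weakening φ) :=
  ⟨{ map := fun f => f
     map_id := fun _ => rfl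
     map_comp := fun _ _ => rfl
     map₂ := fun α => ⟨⟨congrArg φ.map α.down.down⟩⟩
     map₂_one := fun _ => rfl
     map₂_vcomp := fun _ _ => rfl
     map₂_comp₂ := fun _ _ => heq_plift _ _ },
   { toMor := φ
     map₂ := fun α => ⟨⟨α.down.down⟩⟩
     map₂_one := fun _ => rfl
     map₂_vcomp := fun _ _ => rfl
     map₂_comp₂ := fun _ _ => heq_plift _ _ },
   fun _ _ => Function.bijective_id,
   fun _ _ => ⟨fun _ _ _ => eq_of_heq (heq_plift _ _), fun α => ⟨⟨⟨α.down.down⟩⟩, rfl⟩⟩, rfl⟩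

end Multicategory

namespace SymMulticategory

variable {X : Type u}

/-- The functor `D_*` on objects: `M` with only identity 2-cells. -/
def discrete (M : SymMulticategory X) : SymCatMulticategory X where
  toCatMulticategory := M.toMulticategory.discrete
  act := M.act
  act_refl := M.act_refl
  act_act := M.act_act
  act_comp := M.act_comp
  comp_act := M.comp_act
  act₂ σ _ _ _ h _ _ α := ⟨⟨congrArg (M.act σ h) α.down.down⟩⟩
  act₂_one _ _ _ _ _ _ := rfl
  act₂_vcomp _ _ _ _ _ _ _ _ _ _ := rfl
  act_refl₂ _ := heq_plift _ _
  act_act₂ _ _ _ _ _ _ _ _ _ _ _ := heq_plift _ _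
  act_comp₂ _ _ _ _ _ _ _ _ _ _ _ := heq_plift _ _
  comp_act₂ _ _ _ _ _ _ _ _ _ _ _ _ := heq_plift _ _

/-- The functor `D_*` on morphisms. -/
def discreteMap {M N : SymMulticategory X} (φ : M ⟶ N) :
    SymCatMulticategory.Mor M.discrete N.discrete where
  toCatMor := Multicategory.discreteMap φ.toMor
  map_act := φ.map_act
  map₂_act₂ _ _ _ _ _ _ _ _ := heq_plift _ _

/-- `Q` is the weakening determined by `φ : N ⟶ M`: it is the middle term of a factorization of
`D_* φ` into a morphism locally bijective on objects and a locally full and faithful one. -/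
def IsWeakening {N M : SymMulticategory X} (φ : N ⟶ M) (Q : SymCatMulticategory X) : Prop :=
  ∃ (b : SymCatMulticategory.Mor N.discrete Q) (f : SymCatMulticategory.Mor Q M.discrete),
    b.toCatMor.LocallyBijectiveOnObjects ∧ f.toCatMor.LocallyFullyFaithful ∧
      b.comp f = discreteMap φ

/-- The standard model: a unique 2-cell `f → g` if `φ f = φ g`, and none otherwise. -/
def weakening {N M : SymMulticategory X} (φ : N ⟶ M) : SymCatMulticategory X where
  toCatMulticategory := Multicategory.weakening (N := N.toMulticategory)
    (M := M.toMulticategory) φ.toMor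
  act := N.act
  act_refl := N.act_refl
  act_act := N.act_act
  act_comp := N.act_comp
  comp_act := N.comp_act
  act₂ σ _ _ _ h _ _ α :=
    ⟨⟨(φ.map_act σ h _).trans ((congrArg (M.act σ h) α.down.down).trans (φ.map_act σ h _).symm)⟩⟩
  act₂_one _ _ _ _ _ _ := rfl
  act₂_vcomp _ _ _ _ _ _ _ _ _ _ := rfl
  act_refl₂ _ := heq_plift _ _
  act_act₂ _ _ _ _ _ _ _ _ _ _ _ := heq_plift _ _
  act_comp₂ _ _ _ _ _ _ _ _ _ _ _ := heq_plift _ _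
  comp_act₂ _ _ _ _ _ _ _ _ _ _ _ _ := heq_plift _ _

/-- Weakenings exist. -/
theorem isWeakening_weakening {N M : SymMulticategory X} (φ : N ⟶ M) :
    IsWeakening φ (weakening φ) :=
  ⟨{ map := fun f => f
     map_id := fun _ => rfl
     map_comp := fun _ _ => rfl
     map₂ := fun α => ⟨⟨congrArg φ.map α.down.down⟩⟩
     map₂_one := fun _ => rfl
     map₂_vcomp := fun _ _ => rfl
     map₂_comp₂ := fun _ _ => heq_plift _ _
     map_act := fun _ _ _ _ _ _ => rfl
     map₂_act₂ := fun _ _ _ _ _ _ _ _ => heq_plift _ _ },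
   { toMor := φ.toMor
     map₂ := fun α => ⟨⟨α.down.down⟩⟩
     map₂_one := fun _ => rfl
     map₂_vcomp := fun _ _ => rfl
     map₂_comp₂ := fun _ _ => heq_plift _ _
     map_act := φ.map_act
     map₂_act₂ := fun _ _ _ _ _ _ _ _ => heq_plift _ _ },
   fun _ _ => Function.bijective_id,
   fun _ _ => ⟨fun _ _ _ => eq_of_heq (heq_plift _ _), fun α => ⟨⟨⟨α.down.down⟩⟩, rfl⟩⟩, rfl⟩

end SymMulticategory

/-! ### Operads: the case of one object -/

/-- A symmetric operad is a symmetric multicategory with only one object. -/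
abbrev SymOperad : Type (u + 1) := SymMulticategory.{u} PUnit.{u + 1}

/-- A symmetric Cat-operad is a symmetric Cat-multicategory with only one object. -/
abbrev SymCatOperad : Type (u + 1) := SymCatMulticategory.{u} PUnit.{u + 1}

/-- The signature `Φ` (a set `Φ n` of `n`-ary operations for every `n`) as a multigraph with one
vertex. -/
def signatureGraph (Φ : ℕ → Type u) : Multigraph PUnit.{u + 1} :=
  fun n _ _ => Φ n

/-- The free symmetric operad on a signature. -/
noncomputable abbrev FreeSymOperad (Φ : ℕ → Type u) : SymOperad.{u} :=
  FreeSymMulticategory (signatureGraph Φ)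

/-! ### Regular epimorphisms are locally surjective -/

namespace Multicategory

variable {X : Type u}

/-! A weakening of `φ : N ⟶ M` has the arrows of `N` as 1-cells, up to the bijection `b`. Since its
morphism to `D_* M` is locally full and faithful, there is exactly one 2-cell between two 1-cells
with the same image in `M`, and none otherwise. Every equation between 2-cells is then automatic. A
morphism over `M` between the 1-cell parts of two weakenings extends to 2-cells, and any two
morphisms over `M` are joined by an invertible transformation. Two weakenings over `M` are therefore
equivalent as soon as each of their domains maps to the other over `M`; these maps need not be
mutually inverse (`IsWeakening.equivalent`).

Such maps exist between `φ` and the counit because both domains are free. A free multicategory is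
projective with respect to locally surjective morphisms: choose preimages of the images of the
generators and extend (`exists_lift`). The counit is locally surjective because each arrow of `M` is
a generator. A regular epimorphism is locally surjective because it cannot factor through a proper
submulticategory of its target (`map_surjective`). -/

theorem subtype_heq {M : Multicategory X} (S : ∀ {n : ℕ} {c : Fin n → X} {e : X}, M.Hom c e → Prop)
    {m n : ℕ} {c : Fin m → X} {d : Fin n → X} {e : X}
    (h : (⟨m, c⟩ : Σ n, Fin n → X) = ⟨n, d⟩) {s : {f : M.Hom c e // S f}}
    {t : {f : M.Hom d e // S f}} (H : s.1 ≍ t.1) : s ≍ t := by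
  -- The source sequences in the multicategory laws agree only propositionally. Identifying them
  -- reduces the heterogeneous law in a submulticategory to the law in `M`.
  cases h
  exact heq_of_eq (Subtype.ext (eq_of_heq H))

/-- The image of a morphism of multicategories. -/
def image {N M : Multicategory X} (φ : N ⟶ M) : Multicategory X where
  Hom c e := {f : M.Hom c e // ∃ g : N.Hom c e, φ.map g = f}
  id x := ⟨M.id x, N.id x, φ.map_id x⟩
  comp f g := ⟨M.comp f.1 fun i => (g i).1,
    -- Only the existence of a preimage is recorded, so arbitrary preimages of the factors may be
    -- composed.
    N.comp f.2.choose fun i => (g i).2.choose, by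
      rw [φ.map_comp, f.2.choose_spec, funext fun i => (g i).2.choose_spec]⟩
  id_comp {_ c _} f :=
    subtype_heq (fun f => ∃ g, φ.map g = f) (concat_one c) (M.id_comp f.1)
  comp_id {_ c _} f :=
    subtype_heq (fun f => ∃ g, φ.map g = f) (concat_singletons c) (M.comp_id f.1)
  assoc f g h :=
    subtype_heq (fun f => ∃ g, φ.map g = f) (concat_concat _)
      (M.assoc f.1 (fun i => (g i).1) fun i j => (h i j).1)

/-- The inclusion of the image. -/
def imageι {N M : Multicategory X} (φ : N ⟶ M) : image φ ⟶ M where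
  map f := f.1
  map_id _ := rfl
  map_comp _ _ := rfl

/-- The corestriction of a morphism to its image. -/
def toImage {N M : Multicategory X} (φ : N ⟶ M) : N ⟶ image φ where
  map f := ⟨φ.map f, f, rfl⟩
  map_id x := Subtype.ext (φ.map_id x)
  map_comp f g := Subtype.ext (φ.map_comp f g)

theorem hom_ext {N M : Multicategory X} {F G : N ⟶ M}
    (h : ∀ {n : ℕ} {c : Fin n → X} {e : X} (f : N.Hom c e), F.map f = G.map f) : F = G :=
  Multicategory.Mor.ext (by funext n c e f; exact h f)

theorem map_congr {N M : Multicategory X} {F G : N ⟶ M} (h : F = G) {n : ℕ} {c : Fin n → X} {e : X}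
    (f : N.Hom c e) : F.map f = G.map f := by
  rw [h]

/-- A regular epimorphism coequalizes some pair. Its corestriction to the image coequalizes the same
pair, hence descends to a morphism from `M` to the image. That morphism is a section of the
inclusion, so the image is all of `M`. -/
theorem map_surjective {N M : Multicategory X} (φ : N ⟶ M) [IsRegularEpi φ] {n : ℕ}
    {c : Fin n → X} {e : X} (m : M.Hom c e) : ∃ f : N.Hom c e, φ.map f = m := by
  let r := IsRegularEpi.getStruct φ
  have : Epi φ := r.epi
  have hw : r.left ≫ toImage φ = r.right ≫ toImage φ :=
    hom_ext fun f => Subtype.ext (map_congr r.w f)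
  let s : M ⟶ image φ := Limits.Cofork.IsColimit.desc r.isColimit (toImage φ) hw
  have hs : φ ≫ s = toImage φ := Limits.Cofork.IsColimit.π_desc' r.isColimit (toImage φ) hw
  have hi : s ≫ imageι φ = 𝟙 M := by
    -- After precomposition with the epimorphism `φ`, what remains is that corestricting to the
    -- image and then including it gives back `φ`.
    rw [← cancel_epi φ, ← Category.assoc, hs, Category.comp_id]
    rfl
  -- The arrow `s.map m` of the image carries a preimage under `φ`, and by `hi` its underlying arrow
  -- is `m`.
  obtain ⟨g, hg⟩ := (s.map m).2
  exact ⟨g, hg.trans (map_congr hi m)⟩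

/-- The inverse of a locally bijective morphism. -/
noncomputable def inverse {N M : Multicategory X} (b : N ⟶ M)
    (hb : ∀ {n : ℕ} (c : Fin n → X) (e : X), Function.Bijective (b.map : N.Hom c e → M.Hom c e)) :
    M ⟶ N where
  map f := ((hb _ _).2 f).choose
  -- By injectivity of `b`, each law may be checked after applying `b`, where the chosen preimages
  -- cancel.
  map_id x := (hb _ _).1 (((hb _ _).2 _).choose_spec.trans (b.map_id x).symm)
  map_comp f g := (hb _ _).1 (((hb _ _).2 _).choose_spec.trans (by
    rw [b.map_comp, ((hb _ _).2 f).choose_spec, funext fun i => ((hb _ _).2 (g i)).choose_spec]))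

theorem map_inverse {N M : Multicategory X} (b : N ⟶ M)
    (hb : ∀ {n : ℕ} (c : Fin n → X) (e : X), Function.Bijective (b.map : N.Hom c e → M.Hom c e))
    {n : ℕ} {c : Fin n → X} {e : X} (f : M.Hom c e) : b.map ((inverse b hb).map f) = f :=
  ((hb c e).2 f).choose_spec

end Multicategory

/-! ### Images and local surjectivity in the symmetric case. -/

namespace SymMulticategory

variable {X : Type u}

/-- The image of a morphism of symmetric multicategories. -/
def image {N M : SymMulticategory X} (φ : N ⟶ M) : SymMulticategory X where
  toMulticategory := Multicategory.image (N := N.toMulticategory) (M := M.toMulticategory) φ.toMor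
  act σ _ _ _ h f := ⟨M.act σ h f.1, N.act σ h f.2.choose, by
    rw [φ.map_act, f.2.choose_spec]⟩
  act_refl f := Subtype.ext (M.act_refl f.1)
  act_act σ ρ _ _ _ _ h h' f := Subtype.ext (M.act_act σ ρ h h' f.1)
  act_comp σ _ _ _ _ f g := Subtype.ext (M.act_comp σ f.1 fun i => (g i).1)
  comp_act ρ _ _ _ _ h f g := Subtype.ext (M.comp_act ρ h f.1 fun i => (g i).1)

/-- The inclusion of the image. -/
def imageι {N M : SymMulticategory X} (φ : N ⟶ M) : image φ ⟶ M where
  toMor := Multicategory.imageι (N := N.toMulticategory) (M := M.toMulticategory) φ.toMor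
  map_act _ _ _ _ _ _ := rfl

/-- The corestriction of a morphism to its image. -/
def toImage {N M : SymMulticategory X} (φ : N ⟶ M) : N ⟶ image φ where
  toMor := Multicategory.toImage (N := N.toMulticategory) (M := M.toMulticategory) φ.toMor
  map_act σ _ _ _ h f := Subtype.ext (φ.map_act σ h f)

theorem hom_ext {N M : SymMulticategory X} {F G : N ⟶ M}
    (h : ∀ {n : ℕ} {c : Fin n → X} {e : X} (f : N.Hom c e), F.map f = G.map f) : F = G :=
  SymMulticategory.Mor.ext (by funext n c e f; exact h f)

theorem map_congr {N M : SymMulticategory X} {F G : N ⟶ M} (h : F = G) {n : ℕ} {c : Fin n → X}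
    {e : X} (f : N.Hom c e) : F.map f = G.map f := by
  rw [h]

/-- The plain argument carries over because the image of an equivariant morphism is closed under the
symmetric group actions. -/
theorem map_surjective {N M : SymMulticategory X} (φ : N ⟶ M) [IsRegularEpi φ] {n : ℕ}
    {c : Fin n → X} {e : X} (m : M.Hom c e) : ∃ f : N.Hom c e, φ.map f = m := by
  let r := IsRegularEpi.getStruct φ
  have : Epi φ := r.epi
  have hw : r.left ≫ toImage φ = r.right ≫ toImage φ :=
    hom_ext fun f => Subtype.ext (map_congr r.w f)
  let s : M ⟶ image φ := Limits.Cofork.IsColimit.desc r.isColimit (toImage φ) hw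
  have hs : φ ≫ s = toImage φ := Limits.Cofork.IsColimit.π_desc' r.isColimit (toImage φ) hw
  have hi : s ≫ imageι φ = 𝟙 M := by
    rw [← cancel_epi φ, ← Category.assoc, hs, Category.comp_id]
    rfl
  obtain ⟨g, hg⟩ := (s.map m).2
  exact ⟨g, hg.trans (map_congr hi m)⟩

/-- The inverse of a locally bijective morphism. -/
noncomputable def inverse {N M : SymMulticategory X} (b : N ⟶ M)
    (hb : ∀ {n : ℕ} (c : Fin n → X) (e : X), Function.Bijective (b.map : N.Hom c e → M.Hom c e)) :
    M ⟶ N where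
  toMor := Multicategory.inverse (N := N.toMulticategory) (M := M.toMulticategory) b.toMor hb
  map_act σ _ _ _ h f := (hb _ _).1 (((hb _ _).2 _).choose_spec.trans (by
    rw [b.map_act]
    exact congrArg _ ((hb _ _).2 f).choose_spec.symm))

theorem map_inverse {N M : SymMulticategory X} (b : N ⟶ M)
    (hb : ∀ {n : ℕ} (c : Fin n → X) (e : X), Function.Bijective (b.map : N.Hom c e → M.Hom c e))
    {n : ℕ} {c : Fin n → X} {e : X} (f : M.Hom c e) : b.map ((inverse b hb).map f) = f :=
  ((hb c e).2 f).choose_spec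

end SymMulticategory

/-! ### Lifting morphisms out of free multicategories -/

namespace FreeMulticategory

variable {X : Type u}

/-- Evaluation does not depend on the representative picked by `Quotient.out`. -/
theorem lift_unit {Φ : Multigraph X} (M : Multicategory X) (a : MultigraphHom Φ M.graph) {n : ℕ}
    {c : Fin n → X} {e : X} (t : Φ n c e) : (lift M a).map (unit Φ t) = a t :=
  PlainTerm.eval_out M a _

/-- A free multicategory is projective with respect to locally surjective morphisms. -/
theorem exists_lift {Φ : Multigraph X} {N M : Multicategory X} (φ : FreeMulticategory Φ ⟶ M)
    (ψ : N ⟶ M) (hψ : ∀ {n : ℕ} {c : Fin n → X} {e : X} (m : M.Hom c e), ∃ f, ψ.map f = m) :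
    ∃ G : FreeMulticategory Φ ⟶ N, G ≫ ψ = φ := by
  -- The section `s` need not respect composition: it is applied only to images of generators, on
  -- which a morphism out of a free multicategory is unconstrained.
  choose s hs using @hψ
  let G := lift N fun n c e (t : Φ n c e) => s (φ.map (unit Φ t))
  -- `G ≫ ψ` and `φ` agree on generators, hence are equal by the universal property.
  refine ⟨G, (existsUnique_lift M fun n c e (t : Φ n c e) => φ.map (unit Φ t)).unique
    (fun t => ?_) fun _ => rfl⟩
  exact (congrArg ψ.map (lift_unit N _ t)).trans (hs _)

/-- Each arrow of `M` is a generator of the free multicategory on `M.graph`, and the counit sends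
that generator back to the arrow. -/
theorem counit_surjective (M : Multicategory X) {n : ℕ} {c : Fin n → X} {e : X} (m : M.Hom c e) :
    ∃ f, (counit M).map f = m :=
  ⟨unit M.graph m, lift_unit _ _ _⟩

end FreeMulticategory

/-! ### Projectivity of free symmetric multicategories. -/

namespace FreeSymMulticategory

variable {X : Type u}

theorem lift_unit {Φ : Multigraph X} (M : SymMulticategory X) (a : MultigraphHom Φ M.graph) {n : ℕ}
    {c : Fin n → X} {e : X} (t : Φ n c e) : (lift M a).map (unit Φ t) = a t :=
  SymTerm.eval_out M a _

/-- A free symmetric multicategory is projective with respect to locally surjective morphisms. -/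
theorem exists_lift {Φ : Multigraph X} {N M : SymMulticategory X}
    (φ : FreeSymMulticategory Φ ⟶ M) (ψ : N ⟶ M)
    (hψ : ∀ {n : ℕ} {c : Fin n → X} {e : X} (m : M.Hom c e), ∃ f, ψ.map f = m) :
    ∃ G : FreeSymMulticategory Φ ⟶ N, G ≫ ψ = φ := by
  choose s hs using @hψ
  let G := lift N fun n c e (t : Φ n c e) => s (φ.map (unit Φ t))
  refine ⟨G, (existsUnique_lift M fun n c e (t : Φ n c e) => φ.map (unit Φ t)).unique
    (fun t => ?_) fun _ => rfl⟩
  exact (congrArg ψ.map (lift_unit N _ t)).trans (hs _)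

theorem counit_surjective (M : SymMulticategory X) {n : ℕ} {c : Fin n → X} {e : X}
    (m : M.Hom c e) : ∃ f, (counit M).map f = m :=
  ⟨unit M.graph m, lift_unit _ _ _⟩

end FreeSymMulticategory

/-! ### Cat-multicategories with 2-cells detected by a morphism -/

namespace CatMulticategory

variable {X : Type u} {M : Multicategory X}

/-- There is a 2-cell `f ⟶ f'`, then unique, if and only if `p f = p f'`. -/
structure DetectedBy (Q : CatMulticategory X) (p : Q.toMulticategory ⟶ M) : Prop where
  map_eq : ∀ {n : ℕ} {c : Fin n → X} {e : X} {f f' : Q.Hom c e}, (f ⟶ f') → p.map f = p.map f'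
  nonempty : ∀ {n : ℕ} {c : Fin n → X} {e : X} {f f' : Q.Hom c e}, p.map f = p.map f' →
    Nonempty (f ⟶ f')
  subsingleton : ∀ {n : ℕ} {c : Fin n → X} {e : X} (f f' : Q.Hom c e), Subsingleton (f ⟶ f')

/-- A 2-cell of `M.discrete` is a proof of an equation. Applying `f` to a 2-cell yields the
equation, fullness lifts an equation to a 2-cell, and faithfulness gives uniqueness because proofs
are unique. -/
theorem Mor.LocallyFullyFaithful.detectedBy {Q : CatMulticategory X} {f : Mor Q M.discrete}
    (hf : f.LocallyFullyFaithful) : Q.DetectedBy (M := M) f.toMor where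
  map_eq α := (f.map₂ α).down.down
  nonempty h := ⟨((hf _ _).2 ⟨⟨h⟩⟩).choose⟩
  subsingleton _ _ := ⟨fun _ _ => (hf _ _).1 (eq_of_heq (heq_plift _ _))⟩

namespace DetectedBy

variable {Q R : CatMulticategory X} {p : Q.toMulticategory ⟶ M} {q : R.toMulticategory ⟶ M}

/-- Coherence laws compare 2-cells whose endpoints are equal only propositionally. Once the
endpoints are identified, uniqueness of 2-cells settles every such law. -/
theorem heq (hQ : Q.DetectedBy p) {n : ℕ} {c : Fin n → X} {e : X} {f f' g g' : Q.Hom c e}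
    (h : f = g) (h' : f' = g') (α : f ⟶ f') (β : g ⟶ g') : α ≍ β := by
  subst h h'
  exact heq_of_eq ((hQ.subsingleton _ _).elim _ _)

/-- The 2-cell between two 1-cells with the same image. -/
noncomputable def cell (hQ : Q.DetectedBy p) {n : ℕ} {c : Fin n → X} {e : X} {f f' : Q.Hom c e}
    (h : p.map f = p.map f') : f ⟶ f' :=
  (hQ.nonempty h).some

/-- A morphism of multicategories over `M` extends to 2-cells. -/
noncomputable def extend (hQ : Q.DetectedBy p) (hR : R.DetectedBy q)
    (F : Q.toMulticategory ⟶ R.toMulticategory) (hF : F ≫ q = p) : Mor Q R where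
  toMor := F
  -- The 2-cell exists because `q (F f) = p f = p f' = q (F f')`.
  map₂ {_ _ _ f f'} α := hR.cell ((Multicategory.map_congr hF f).trans
    ((hQ.map_eq α).trans (Multicategory.map_congr hF f').symm))
  map₂_one _ := (hR.subsingleton _ _).elim _ _
  map₂_vcomp _ _ := (hR.subsingleton _ _).elim _ _
  map₂_comp₂ _ _ := hR.heq (F.map_comp _ _) (F.map_comp _ _) _ _

/-- The transformation between two morphisms over `M`. -/
noncomputable def transformation (hR : R.DetectedBy q) (F G : Mor Q R)
    (h : ∀ {n : ℕ} {c : Fin n → X} {e : X} (f : Q.Hom c e),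
      q.map (F.map f) = q.map (G.map f)) : Transformation F G where
  app f := hR.cell (h f)
  naturality _ := (hR.subsingleton _ _).elim _ _
  app_id _ := hR.heq (F.map_id _) (G.map_id _) _ _
  app_comp _ _ := hR.heq (F.map_comp _ _) (G.map_comp _ _) _ _

/-- Two morphisms over `M` are isomorphic. -/
noncomputable def transformationIso (hR : R.DetectedBy q) (F G : Mor Q R)
    (h : ∀ {n : ℕ} {c : Fin n → X} {e : X} (f : Q.Hom c e),
      q.map (F.map f) = q.map (G.map f)) : TransformationIso F G where
  hom := hR.transformation F G h
  inv := hR.transformation G F fun f => (h f).symm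
  hom_inv_id _ := (hR.subsingleton _ _).elim _ _
  inv_hom_id _ := (hR.subsingleton _ _).elim _ _

/-- Both round trips lie over `M`, as do the identities, so each is isomorphic to the identity
although `F` and `G` need not be inverse. -/
theorem equivalent (hQ : Q.DetectedBy p) (hR : R.DetectedBy q)
    (F : Q.toMulticategory ⟶ R.toMulticategory) (hF : F ≫ q = p)
    (G : R.toMulticategory ⟶ Q.toMulticategory) (hG : G ≫ p = q) : Equivalent Q R :=
  ⟨hQ.extend hR F hF, hR.extend hQ G hG,
    ⟨hQ.transformationIso _ _ fun f =>
      (Multicategory.map_congr hG (F.map f)).trans (Multicategory.map_congr hF f)⟩,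
    ⟨hR.transformationIso _ _ fun f =>
      (Multicategory.map_congr hF (G.map f)).trans (Multicategory.map_congr hG f)⟩⟩

end DetectedBy

end CatMulticategory

/-! ### Detected 2-cells in the symmetric case. -/

namespace SymCatMulticategory

variable {X : Type u} {M : SymMulticategory X} {Q R : SymCatMulticategory X}
  {p : Q.toSymMulticategory ⟶ M} {q : R.toSymMulticategory ⟶ M}

/-- There is a 2-cell `f ⟶ f'`, then unique, if and only if `p f = p f'`. -/
abbrev DetectedBy (Q : SymCatMulticategory X) (p : Q.toSymMulticategory ⟶ M) : Prop :=
  Q.toCatMulticategory.DetectedBy (M := M.toMulticategory) p.toMor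

namespace DetectedBy

/-- A morphism of symmetric multicategories over `M` extends to 2-cells. -/
noncomputable def extend (hQ : Q.DetectedBy p) (hR : R.DetectedBy q)
    (F : Q.toSymMulticategory ⟶ R.toSymMulticategory) (hF : F ≫ q = p) : Mor Q R where
  toCatMor := CatMulticategory.DetectedBy.extend hQ hR F.toMor (congrArg SymMulticategory.Mor.toMor hF)
  map_act := F.map_act
  map₂_act₂ σ _ _ _ h _ _ _ :=
    CatMulticategory.DetectedBy.heq hR (F.map_act σ h _) (F.map_act σ h _) _ _

/-- The transformation between two morphisms over `M`. -/
noncomputable def transformation (hR : R.DetectedBy q) (F G : Mor Q R)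
    (h : ∀ {n : ℕ} {c : Fin n → X} {e : X} (f : Q.Hom c e),
      q.map (F.map f) = q.map (G.map f)) : Transformation F G where
  toTransformation := CatMulticategory.DetectedBy.transformation hR F.toCatMor G.toCatMor h
  app_act σ _ _ _ h _ :=
    CatMulticategory.DetectedBy.heq hR (F.map_act σ h _) (G.map_act σ h _) _ _

/-- Two morphisms over `M` are isomorphic. -/
noncomputable def transformationIso (hR : R.DetectedBy q) (F G : Mor Q R)
    (h : ∀ {n : ℕ} {c : Fin n → X} {e : X} (f : Q.Hom c e),
      q.map (F.map f) = q.map (G.map f)) : TransformationIso F G where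
  hom := hR.transformation F G h
  inv := hR.transformation G F fun f => (h f).symm
  hom_inv_id _ := (hR.subsingleton _ _).elim _ _
  inv_hom_id _ := (hR.subsingleton _ _).elim _ _

/-- Compared with the plain case, only equivariance is new. On 1-cells it comes from `F` and `G`; on
2-cells and for transformations it follows from uniqueness of 2-cells. -/
theorem equivalent (hQ : Q.DetectedBy p) (hR : R.DetectedBy q)
    (F : Q.toSymMulticategory ⟶ R.toSymMulticategory) (hF : F ≫ q = p)
    (G : R.toSymMulticategory ⟶ Q.toSymMulticategory) (hG : G ≫ p = q) : Equivalent Q R :=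
  ⟨extend hQ hR F hF, extend hR hQ G hG,
    ⟨transformationIso hQ _ _ fun f =>
      (SymMulticategory.map_congr hG (F.map f)).trans (SymMulticategory.map_congr hF f)⟩,
    ⟨transformationIso hR _ _ fun f =>
      (SymMulticategory.map_congr hF (G.map f)).trans (SymMulticategory.map_congr hG f)⟩⟩

end DetectedBy

end SymCatMulticategory

/-! ### Equivalence of weakenings -/

namespace Multicategory

variable {X : Type u} {M : Multicategory X}

/-- Distils a weakening to what the comparison needs: detected 2-cells, and maps over `M` in both
directions between `N` and the 1-cells, namely `b` and its inverse. -/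
theorem IsWeakening.exists_detectedBy {N : Multicategory X} {φ : N ⟶ M} {Q : CatMulticategory X}
    (hQ : IsWeakening φ Q) :
    ∃ (p : Q.toMulticategory ⟶ M) (b : N ⟶ Q.toMulticategory) (b' : Q.toMulticategory ⟶ N),
      Q.DetectedBy p ∧ b ≫ p = φ ∧ b' ≫ φ = p := by
  obtain ⟨b, f, hb, hf, h⟩ := hQ
  have hφ : (b.toMor : N ⟶ Q.toMulticategory) ≫ (f.toMor : Q.toMulticategory ⟶ M) = φ :=
    congrArg CatMulticategory.Mor.toMor h
  refine ⟨f.toMor, b.toMor, inverse (N := N) (M := Q.toMulticategory) b.toMor hb,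
    hf.detectedBy, hφ, hom_ext fun g => ?_⟩
  -- With `φ` written as `b` followed by `f`, the map `b` cancels its inverse.
  rw [← hφ]
  exact congrArg f.map (map_inverse (N := N) (M := Q.toMulticategory) b.toMor hb g)

/-- `F` and `G` are transported to the 1-cells of `Q` and `R` along the identifications with `N` and
`N'`. Freeness plays no role here; identities for `F` and `G` show that any two weakenings of one
morphism are equivalent. -/
theorem IsWeakening.equivalent {N N' : Multicategory X} {φ : N ⟶ M} {ψ : N' ⟶ M}
    {Q R : CatMulticategory X} (hQ : IsWeakening φ Q) (hR : IsWeakening ψ R)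
    (F : N ⟶ N') (hF : F ≫ ψ = φ) (G : N' ⟶ N) (hG : G ≫ φ = ψ) :
    CatMulticategory.Equivalent Q R := by
  obtain ⟨p, b, b', hp, hb, hb'⟩ := hQ.exists_detectedBy
  obtain ⟨q, a, a', hq, ha, ha'⟩ := hR.exists_detectedBy
  exact hp.equivalent hq (b' ≫ F ≫ a) (by rw [Category.assoc, Category.assoc, ha, hF, hb'])
    (a' ≫ G ≫ b) (by rw [Category.assoc, Category.assoc, hb, hG, ha'])

end Multicategory

/-! ### Comparison of symmetric weakenings. -/

namespace SymMulticategory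

variable {X : Type u} {M : SymMulticategory X}

theorem IsWeakening.exists_detectedBy {N : SymMulticategory X} {φ : N ⟶ M}
    {Q : SymCatMulticategory X} (hQ : IsWeakening φ Q) :
    ∃ (p : Q.toSymMulticategory ⟶ M) (b : N ⟶ Q.toSymMulticategory)
      (b' : Q.toSymMulticategory ⟶ N), Q.DetectedBy p ∧ b ≫ p = φ ∧ b' ≫ φ = p := by
  obtain ⟨b, f, hb, hf, h⟩ := hQ
  have hφ : (b.toSymMor : N ⟶ Q.toSymMulticategory) ≫ (f.toSymMor : Q.toSymMulticategory ⟶ M) =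
      φ := congrArg SymCatMulticategory.Mor.toSymMor h
  refine ⟨f.toSymMor, b.toSymMor, inverse (N := N) (M := Q.toSymMulticategory) b.toSymMor hb,
    hf.detectedBy, hφ, hom_ext fun g => ?_⟩
  rw [← hφ]
  exact congrArg f.map (map_inverse (N := N) (M := Q.toSymMulticategory) b.toSymMor hb g)

theorem IsWeakening.equivalent {N N' : SymMulticategory X} {φ : N ⟶ M} {ψ : N' ⟶ M}
    {Q R : SymCatMulticategory X} (hQ : IsWeakening φ Q) (hR : IsWeakening ψ R)
    (F : N ⟶ N') (hF : F ≫ ψ = φ) (G : N' ⟶ N) (hG : G ≫ φ = ψ) :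
    SymCatMulticategory.Equivalent Q R := by
  obtain ⟨p, b, b', hp, hb, hb'⟩ := hQ.exists_detectedBy
  obtain ⟨q, a, a', hq, ha, ha'⟩ := hR.exists_detectedBy
  exact SymCatMulticategory.DetectedBy.equivalent hp hq
    (b' ≫ F ≫ a) (by rw [Category.assoc, Category.assoc, ha, hF, hb'])
    (a' ≫ G ≫ b) (by rw [Category.assoc, Category.assoc, hb, hG, ha'])

/-- The weakening determined by a regular epimorphism is equivalent to the unbiased one. -/
theorem IsWeakening.equivalent_unbiased {Φ : Multigraph X} {φ : FreeSymMulticategory Φ ⟶ M}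
    [IsRegularEpi φ] {Q W : SymCatMulticategory X} (hQ : IsWeakening φ Q)
    (hW : IsWeakening (FreeSymMulticategory.counit M) W) :
    SymCatMulticategory.Equivalent Q W := by
  obtain ⟨F, hF⟩ := FreeSymMulticategory.exists_lift φ (FreeSymMulticategory.counit M)
    (FreeSymMulticategory.counit_surjective M)
  -- The only use of regularity: the counit lifts through `φ` because `φ` is locally surjective.
  obtain ⟨G, hG⟩ := FreeSymMulticategory.exists_lift (FreeSymMulticategory.counit M) φ
    (map_surjective φ)
  exact hQ.equivalent hW F hF G hG

end SymMulticategory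

/-- The weakening determined by a regular epimorphism is equivalent to the unbiased one. -/
theorem Multicategory.IsWeakening.equivalent_unbiased {X : Type u} {M : Multicategory X}
    {Φ : Multigraph X} {φ : FreeMulticategory Φ ⟶ M} [IsRegularEpi φ] {Q W : CatMulticategory X}
    (hQ : IsWeakening φ Q) (hW : IsWeakening (FreeMulticategory.counit M) W) :
    CatMulticategory.Equivalent Q W := by
  obtain ⟨F, hF⟩ := FreeMulticategory.exists_lift φ (FreeMulticategory.counit M)
    (FreeMulticategory.counit_surjective M)
  obtain ⟨G, hG⟩ := FreeMulticategory.exists_lift (FreeMulticategory.counit M) φ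
    (map_surjective φ)
  exact hQ.equivalent hW F hF G hG

theorem mainTheorem3 :
    -- symmetric operads
    (∀ (P : SymOperad.{u}) (Φ : ℕ → Type u) (φ : FreeSymOperad Φ ⟶ P), IsRegularEpi φ →
      ∀ Q W : SymCatOperad.{u}, SymMulticategory.IsWeakening φ Q →
        SymMulticategory.IsWeakening (FreeSymMulticategory.counit P) W →
        SymCatMulticategory.Equivalent Q W) ∧
    -- plain multicategories
    (∀ (X : Type u) (M : Multicategory.{u} X) (Φ : Multigraph X) (φ : FreeMulticategory Φ ⟶ M),
      IsRegularEpi φ →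
      ∀ Q W : CatMulticategory.{u} X, Multicategory.IsWeakening φ Q →
        Multicategory.IsWeakening (FreeMulticategory.counit M) W →
        CatMulticategory.Equivalent Q W) ∧
    -- symmetric multicategories
    (∀ (X : Type u) (M : SymMulticategory.{u} X) (Φ : Multigraph X)
      (φ : FreeSymMulticategory Φ ⟶ M), IsRegularEpi φ →
      ∀ Q W : SymCatMulticategory.{u} X, SymMulticategory.IsWeakening φ Q →
        SymMulticategory.IsWeakening (FreeSymMulticategory.counit M) W →
        SymCatMulticategory.Equivalent Q W) :=
  -- `FreeSymOperad Φ` unfolds to a free symmetric multicategory on one object, so operads are a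
  -- special case of the third clause.
  ⟨fun _ _ _ _ _ _ hQ hW => hQ.equivalent_unbiased hW,
    fun _ _ _ _ _ _ _ hQ hW => hQ.equivalent_unbiased hW,
    fun _ _ _ _ _ _ _ hQ hW => hQ.equivalent_unbiased hW⟩
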